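/- A topological space $X$ is called selectively highly divergent (SHD) if for every sequence $(U_n)_{n\in\omega}$ of non-empty open subsets of $X$ there are points $x_n\in U_n$ such that the sequence $(x_n)_{n\in\omega}$ has no convergent subsequence. For a Hausdorff space $X$, let $R(X)$ be the Boolean algebra of regular closed subsets of $X$ (those $A$ with $A=\operatorname{cl}(\operatorname{int}A)$), ordered by inclusion, with meet $A\wedge B=\operatorname{cl}(\operatorname{int}(A\cap B))$, and let $\theta X$ be the set of all ultrafilters (maximal proper filters) of $R(X)$, with the topology that has the sets $\lambda(A)=\{\mathscr U\in\theta X: A\in\mathscr U\}$, $A\in R(X)$, as a base. Let $D(2)^{\mathfrak m}$ denote the product of $\mathfrak m$ copies of the two-point discrete space, let $d(X)$ be the least cardinality of a dense subset of $X$ and $w(X)$ the least cardinality of a base of $X$; a space is zero-dimensional if its clopen sets form a base. Theorem. Assume the Generalized Continuum Hypothesis ($2^{\lambda}=\lambda^{+}$ for every infinite cardinal $\lambda$). Then for every infinite cardinal $\kappa$ the space $Z_\kappa=\theta\bigl(D(2)^{2^{\kappa}}\bigr)$ is compact, Hausdorff, zero-dimensional and SHD, and it satisfies $d(Z_\kappa)=\kappa$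 and $w(Z_\kappa)=2^{\kappa}$. -/

import Mathlib

open Cardinal Set Filter Topology

universe u

/-- The Generalized Continuum Hypothesis: `2 ^ c` is the cardinal successor of `c`, for every
infinite cardinal `c`. -/
def GCH : Prop := ∀ c : Cardinal.{u}, ℵ₀ ≤ c → 2 ^ c = Order.succ c

/-- The least cardinality of a dense subset of `X`. -/
noncomputable def density (X : Type u) [TopologicalSpace X] : Cardinal.{u} :=
  sInf {c | ∃ D : Set X, Dense D ∧ #D = c}

/-- The least cardinality of a base of `X`. -/
noncomputable def weight (X : Type u) [TopologicalSpace X] : Cardinal.{u} :=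
  sInf {c | ∃ B : Set (Set X), TopologicalSpace.IsTopologicalBasis B ∧ #B = c}

/-- The clopen sets form a base of the topology. -/
def IsZeroDimensional (X : Type u) [TopologicalSpace X] : Prop :=
  TopologicalSpace.IsTopologicalBasis {s : Set X | IsClopen s}

/-- Selectively highly divergent spaces: from every sequence of non-empty open sets one can select
points that form a sequence without convergent subsequences. -/
def IsSHD (X : Type u) [TopologicalSpace X] : Prop :=
  ∀ U : ℕ → Set X, (∀ n, IsOpen (U n) ∧ (U n).Nonempty) →
    ∃ x : ℕ → X, (∀ n, x n ∈ U n) ∧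
      ∀ φ : ℕ → ℕ, StrictMono φ → ∀ a : X, ¬ Tendsto (x ∘ φ) atTop (𝓝 a)

section RegularClosed

variable {X : Type u} [TopologicalSpace X]

/-- Regular closed sets: the members of the Boolean algebra `R(X)`, which is ordered by inclusion
and in which the meet of `A` and `B` is `closure (interior (A ∩ B))`. -/
def IsRegularClosed (A : Set X) : Prop := closure (interior A) = A

/-- Proper filters of the Boolean algebra `R(X)` of regular closed sets. -/
structure IsRegularClosedFilter (F : Set (Set X)) : Prop where
  regularClosed : ∀ A ∈ F, IsRegularClosed A
  nonempty : F.Nonempty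
  empty_notMem : ∅ ∉ F
  meet_mem : ∀ A ∈ F, ∀ B ∈ F, closure (interior (A ∩ B)) ∈ F
  mem_of_subset : ∀ A ∈ F, ∀ B, IsRegularClosed B → A ⊆ B → B ∈ F

variable (X) in
/-- The set `θX` of all ultrafilters (maximal proper filters) of `R(X)`. -/
def Theta : Type u := {F : Set (Set X) // Maximal IsRegularClosedFilter F}

/-- `λ(A)`, the set of all ultrafilters of `R(X)` that contain `A`. -/
def Theta.lam (A : Set X) : Set (Theta X) := {F | A ∈ F.1}

/-- The topology on `θX` with base `{λ(A) : A ∈ R(X)}`. -/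
instance : TopologicalSpace (Theta X) :=
  TopologicalSpace.generateFrom {s | ∃ A : Set X, IsRegularClosed A ∧ Theta.lam A = s}

end RegularClosed

/-- The Cantor cube `D(2)^m`, with the product topology (`Bool` is discrete). -/
abbrev CantorCube (m : Cardinal.{u}) : Type u := m.out → Bool

/-- The space `Z_κ = θ(D(2)^(2^κ))`. -/
abbrev ZSpace (κ : Cardinal.{u}) : Type u := Theta (CantorCube (2 ^ κ))

theorem isRegularClosed_closure_interior {X : Type u} [TopologicalSpace X] (A : Set X) :
    IsRegularClosed (closure (interior A)) :=
  Subset.antisymm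
    (closure_minimal interior_subset isClosed_closure)
    (closure_mono (interior_maximal subset_closure isOpen_interior))

/-- The sets `λ(A)` form a base of `θX`, not only a subbase. -/
theorem Theta.isTopologicalBasis {X : Type u} [TopologicalSpace X] :
    TopologicalSpace.IsTopologicalBasis {s : Set (Theta X) | ∃ A : Set X, IsRegularClosed A ∧ Theta.lam A = s} where
  exists_subset_inter := by
    rintro _ ⟨A, hA, rfl⟩ _ ⟨B, hB, rfl⟩ F ⟨hFA, hFB⟩
    refine ⟨_, ⟨_, isRegularClosed_closure_interior (A ∩ B), rfl⟩,
      F.2.prop.meet_mem A hFA B hFB, fun G hG => ?_⟩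
    have h : closure (interior (A ∩ B)) ⊆ closure (interior A) ∩ closure (interior B) :=
      subset_inter (closure_mono (interior_mono inter_subset_left))
        (closure_mono (interior_mono inter_subset_right))
    rw [hA, hB] at h
    exact ⟨G.2.prop.mem_of_subset _ hG A hA (h.trans inter_subset_left),
      G.2.prop.mem_of_subset _ hG B hB (h.trans inter_subset_right)⟩
  sUnion_eq := by
    refine eq_univ_of_forall fun F => ?_
    obtain ⟨A, hA⟩ := F.2.prop.nonempty
    exact ⟨_, ⟨A, F.2.prop.regularClosed A hA, rfl⟩, hA⟩
  eq_generateFrom := rfl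

/-! `Theta X` is the Stone space of the complete Boolean algebra of regular closed sets, hence
compact, Hausdorff, zero-dimensional and extremally disconnected. In an extremally disconnected
Hausdorff space only eventually constant sequences converge. Without isolated points, non-empty open
sets are infinite, so distinct points can be selected, and SHD follows. For the cardinals, the cube
has a dense set of size at most `κ` (`exists_dense_cube`). It yields density at most `κ`, and weight
at most `2 ^ κ` because a regular closed set is determined by the trace of its interior on a dense
set. Conversely, the coordinates give `2 ^ κ` clopen sets; compactness bounds their number by the
weight, and in any space it is at most `2 ^ density`. GCH enters only to deduce `κ ≤ density`. -/

section Sequences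

/-- In an extremally disconnected Hausdorff space no sequence of points different from `a`
converges to `a`. -/
theorem not_tendsto_of_extremallyDisconnected {Y : Type*} [TopologicalSpace Y] [T2Space Y]
    [ExtremallyDisconnected Y] {x : ℕ → Y} {a : Y} (hx : ∀ n, x n ≠ a) :
    ¬ Tendsto x atTop (𝓝 a) := by
  intro ht
  choose V hV hxV haV using fun n => exists_isClopen_of_totally_separated (hx n)
  -- The disjoint open sets `disjointed V n` cover the sequence, and each contains only finitely
  -- many of its terms. A subsequence thus meets each at most once; its even and odd terms lie in
  -- disjoint open sets, both having `a` in their closure.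
  have hW : ∀ n, IsOpen (disjointed V n) := fun n => by
    rw [disjointed_eq_inter_compl]
    exact (hV n).isOpen.inter
      ((Set.finite_lt_nat n).isOpen_biInter fun i _ => (hV i).compl.isOpen)
  have hdisj := disjoint_disjointed V
  have hcov : ∀ m, ∃ n, x m ∈ disjointed V n := fun m => by
    have : x m ∈ ⋃ n, disjointed V n := by
      rw [iUnion_disjointed]
      exact mem_iUnion_of_mem m (hxV m)
    simpa using this
  choose f hf using hcov
  have hfin : ∀ n, ∀ᶠ m in atTop, f m ≠ n := fun n => by
    filter_upwards [ht ((hV n).compl.isOpen.mem_nhds (haV n))] with m hm h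
    exact hm (disjointed_subset V n (h ▸ hf m))
  have hftop : Tendsto f atTop atTop := by
    refine tendsto_atTop.2 fun b => ?_
    filter_upwards [(Set.finite_lt_nat b).eventually_all.2 fun n _ => hfin n] with m hm
    by_contra! h
    exact hm (f m) h rfl
  obtain ⟨φ, hφ, hfφ⟩ := strictMono_subseq_of_tendsto_atTop hftop
  have hmem : ∀ g : ℕ → ℕ, StrictMono g →
      a ∈ closure (⋃ k, disjointed V (f (φ (g k)))) := fun g hg =>
    mem_closure_of_tendsto (ht.comp (hφ.comp hg).tendsto_atTop)
      (Eventually.of_forall fun k => mem_iUnion_of_mem k (hf _))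
  have hd : Disjoint (⋃ k, disjointed V (f (φ (2 * k))))
      (⋃ k, disjointed V (f (φ (2 * k + 1)))) := by
    refine disjoint_iUnion_left.2 fun k => disjoint_iUnion_right.2 fun l => hdisj fun h => ?_
    have := hfφ.injective h
    omega
  exact disjoint_left.1
    (ExtremallyDisconnected.disjoint_closure_of_disjoint_isOpen hd
      (isOpen_iUnion fun _ => hW _) (isOpen_iUnion fun _ => hW _))
    (hmem (fun k => 2 * k) fun _ _ h => by dsimp only; omega)
    (hmem (fun k => 2 * k + 1) fun _ _ h => by dsimp only; omega)

/-- A sequence of infinite sets has an injective sequence of representatives. -/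
theorem exists_injective_mem_of_infinite {Y : Type*} {U : ℕ → Set Y} (hU : ∀ n, (U n).Infinite) :
    ∃ x : ℕ → Y, Function.Injective x ∧ ∀ n, x n ∈ U n := by
  classical
  -- With `n + 1` candidates at index `n`, Hall's condition for `s` holds already because of the
  -- largest index in `s`.
  choose t ht htc using fun n => (hU n).exists_subset_card_eq (n + 1)
  obtain ⟨x, hx, hxt⟩ := (Finset.all_card_le_biUnion_card_iff_exists_injective t).1 fun s => by
    rcases s.eq_empty_or_nonempty with rfl | hs
    · simp
    calc s.card ≤ (Finset.range (s.max' hs + 1)).card :=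
          Finset.card_le_card fun n hn => by
            simpa [Nat.lt_succ_iff] using s.le_max' n hn
      _ = (t (s.max' hs)).card := by rw [htc, Finset.card_range]
      _ ≤ (s.biUnion t).card :=
          Finset.card_le_card (Finset.subset_biUnion_of_mem t (s.max'_mem hs))
  exact ⟨x, hx, fun n => ht n (hxt n)⟩

/-- Extremally disconnected Hausdorff spaces without isolated points are selectively highly
divergent. -/
theorem isSHD_of_extremallyDisconnected {Y : Type u} [TopologicalSpace Y] [T2Space Y]
    [ExtremallyDisconnected Y] (hY : ∀ y : Y, ¬ IsOpen {y}) : IsSHD Y := by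
  intro U hU
  have hinf : ∀ n, (U n).Infinite := fun n => by
    obtain ⟨y, hy⟩ := (hU n).2
    have : (𝓝[≠] y).NeBot := by
      rw [neBot_iff, Ne, ← isOpen_singleton_iff_punctured_nhds]
      exact hY y
    exact infinite_of_mem_nhds y ((hU n).1.mem_nhds hy)
  obtain ⟨x, hx, hxU⟩ := exists_injective_mem_of_infinite hinf
  refine ⟨x, hxU, fun φ hφ a ht => ?_⟩
  have hinj : Function.Injective (x ∘ φ) := hx.comp hφ.injective
  -- An injective sequence takes the value `a` at most once, so a tail avoids it.
  obtain ⟨N, hN⟩ : ∃ N, ∀ n, x (φ (n + N)) ≠ a := by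
    by_cases h : ∃ m, x (φ m) = a
    · obtain ⟨m, hm⟩ := h
      refine ⟨m + 1, fun n hn => ?_⟩
      have := hinj (hn.trans hm.symm)
      omega
    · exact ⟨0, fun n hn => h ⟨_, hn⟩⟩
  exact not_tendsto_of_extremallyDisconnected hN (ht.comp (tendsto_add_atTop_nat N))

end Sequences

/-! ### Stone duality for the algebra of regular closed sets -/

section Stone

variable {X : Type u} [TopologicalSpace X]

theorem isRegularClosed_closure_of_isOpen {O : Set X} (hO : IsOpen O) :
    IsRegularClosed (closure O) := by
  simpa only [hO.interior_eq] using isRegularClosed_closure_interior O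

theorem IsClopen.isRegularClosed {A : Set X} (hA : IsClopen A) : IsRegularClosed A := by
  rw [IsRegularClosed, hA.isOpen.interior_eq, hA.isClosed.closure_eq]

theorem IsRegularClosed.isClosed {A : Set X} (hA : IsRegularClosed A) : IsClosed A :=
  hA ▸ isClosed_closure

theorem IsRegularClosed.interior_nonempty {A : Set X} (hA : IsRegularClosed A)
    (h : A.Nonempty) : (interior A).Nonempty := by
  rwa [← hA, closure_nonempty_iff] at h

theorem closure_interior_inter_subset {A B : Set X} (hA : IsRegularClosed A)
    (hB : IsRegularClosed B) : closure (interior (A ∩ B)) ⊆ A ∩ B :=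
  closure_minimal interior_subset (hA.isClosed.inter hB.isClosed)

theorem IsRegularClosedFilter.interior_inter_nonempty {F : Set (Set X)}
    (hF : IsRegularClosedFilter F) {A B : Set X} (hA : A ∈ F) (hB : B ∈ F) :
    (interior (A ∩ B)).Nonempty := by
  by_contra! h
  have := hF.meet_mem A hA B hB
  rw [h, closure_empty] at this
  exact hF.empty_notMem this

theorem IsRegularClosedFilter.exists_maximal {F : Set (Set X)} (hF : IsRegularClosedFilter F) :
    ∃ G : Theta X, F ⊆ G.1 := by
  obtain ⟨G, hFG, hG⟩ := zorn_subset_nonempty {F : Set (Set X) | IsRegularClosedFilter F}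
    (fun c hc hch ⟨F₀, hF₀⟩ => by
      refine ⟨⋃₀ c, ?_, fun s hs => subset_sUnion_of_mem hs⟩
      refine ⟨?_, ?_, ?_, ?_, ?_⟩
      · rintro A ⟨F, hF, hA⟩
        exact (hc hF).regularClosed A hA
      · obtain ⟨A, hA⟩ := (hc hF₀).nonempty
        exact ⟨A, F₀, hF₀, hA⟩
      · rintro ⟨F, hF, h⟩
        exact (hc hF).empty_notMem h
      · rintro A ⟨F, hF, hA⟩ B ⟨G, hG, hB⟩
        obtain ⟨K, hK, hFK, hGK⟩ := hch.directedOn F hF G hG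
        exact ⟨K, hK, (hc hK).meet_mem A (hFK hA) B (hGK hB)⟩
      · rintro A ⟨F, hF, hA⟩ B hB hAB
        exact ⟨F, hF, (hc hF).mem_of_subset A hA B hB hAB⟩) F hF
  exact ⟨⟨G, hG⟩, hFG⟩

theorem isRegularClosedFilter_setOf_mem_interior (x : X) :
    IsRegularClosedFilter {A : Set X | IsRegularClosed A ∧ x ∈ interior A} where
  regularClosed _ hA := hA.1
  nonempty := ⟨univ, isClopen_univ.isRegularClosed, by simp⟩
  empty_notMem h := by simpa using h.2
  meet_mem A hA B hB := by
    refine ⟨isRegularClosed_closure_interior _,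
      interior_maximal subset_closure isOpen_interior ?_⟩
    rw [interior_inter]
    exact ⟨hA.2, hB.2⟩
  mem_of_subset _ hA _ hB h := ⟨hB, interior_mono h hA.2⟩

/-- Substitute for a map from `X` to `Theta X`: it carries points and dense sets over. The
ultrafilter is a choice, since the neighbourhood filter need not be maximal. -/
theorem Theta.exists_of_mem_interior (x : X) :
    ∃ F : Theta X, ∀ A, IsRegularClosed A → x ∈ interior A → A ∈ F.1 := by
  obtain ⟨F, hF⟩ := (isRegularClosedFilter_setOf_mem_interior x).exists_maximal
  exact ⟨F, fun A hA hx => hF ⟨hA, hx⟩⟩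

theorem Theta.lam_empty : Theta.lam (∅ : Set X) = ∅ :=
  eq_empty_of_forall_notMem fun F h => F.2.prop.empty_notMem h

theorem Theta.lam_mono {A B : Set X} (hB : IsRegularClosed B) (h : A ⊆ B) :
    Theta.lam A ⊆ Theta.lam B :=
  fun F hF => F.2.prop.mem_of_subset A hF B hB h

theorem Theta.lam_meet {A B : Set X} (hA : IsRegularClosed A) (hB : IsRegularClosed B) :
    Theta.lam (closure (interior (A ∩ B))) = Theta.lam A ∩ Theta.lam B := by
  have h := closure_interior_inter_subset hA hB
  exact Subset.antisymm
    (subset_inter (Theta.lam_mono hA (h.trans inter_subset_left))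
      (Theta.lam_mono hB (h.trans inter_subset_right)))
    fun F hF => F.2.prop.meet_mem A hF.1 B hF.2

theorem interior_inter_closure_compl (A : Set X) : interior (A ∩ closure Aᶜ) = ∅ := by
  rw [interior_inter, closure_compl, ← disjoint_iff_inter_eq_empty]
  exact disjoint_compl_right.mono_right interior_subset

/-- The filter generated by `F` and `A` is proper, so maximality puts `A` in `F`. -/
theorem Theta.mem_of_forall_interior_inter_nonempty (F : Theta X) {A : Set X}
    (hA : IsRegularClosed A) (h : ∀ B ∈ F.1, (interior (A ∩ B)).Nonempty) : A ∈ F.1 := by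
  have hF := F.2.prop
  let G : Set (Set X) := {C | IsRegularClosed C ∧ ∃ B ∈ F.1, closure (interior (A ∩ B)) ⊆ C}
  have hG : IsRegularClosedFilter G := by
    refine ⟨fun C hC => hC.1, ?_, ?_, ?_, ?_⟩
    · obtain ⟨B, hB⟩ := hF.nonempty
      exact ⟨_, isRegularClosed_closure_interior (A ∩ B), B, hB, Subset.rfl⟩
    · rintro ⟨-, B, hB, hsub⟩
      exact ((h B hB).mono (subset_closure.trans hsub)).ne_empty rfl
    · rintro C ⟨hC, B, hB, hBC⟩ D ⟨hD, B', hB', hBD⟩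
      refine ⟨isRegularClosed_closure_interior _, _, hF.meet_mem B hB B' hB', ?_⟩
      have hs := closure_interior_inter_subset (hF.regularClosed B hB) (hF.regularClosed B' hB')
      refine closure_mono (interior_maximal (subset_inter ?_ ?_) isOpen_interior)
      · exact (interior_mono (inter_subset_inter_right A (hs.trans inter_subset_left))).trans
          (subset_closure.trans hBC)
      · exact (interior_mono (inter_subset_inter_right A (hs.trans inter_subset_right))).trans
          (subset_closure.trans hBD)
    · rintro C ⟨-, B, hB, hBC⟩ D hD hCD
      exact ⟨hD, B, hB, hBC.trans hCD⟩
  have hFG : F.1 ⊆ G := fun B hB =>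
    ⟨hF.regularClosed B hB, B, hB,
      (closure_interior_inter_subset hA (hF.regularClosed B hB)).trans inter_subset_right⟩
  obtain ⟨B, hB⟩ := hF.nonempty
  exact F.2.le_of_ge hG hFG
    ⟨hA, B, hB, (closure_interior_inter_subset hA (hF.regularClosed B hB)).trans inter_subset_left⟩

theorem Theta.lam_closure_compl {A : Set X} (hA : IsRegularClosed A) :
    Theta.lam (closure Aᶜ) = (Theta.lam A)ᶜ := by
  have hA' : IsRegularClosed (closure Aᶜ) :=
    isRegularClosed_closure_of_isOpen hA.isClosed.isOpen_compl
  refine Subset.antisymm (fun F hF hFA => ?_) fun F hF => ?_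
  · have := F.2.prop.interior_inter_nonempty hFA hF
    rw [interior_inter_closure_compl] at this
    exact this.ne_empty rfl
  · by_contra hF'
    refine hF (F.mem_of_forall_interior_inter_nonempty hA fun B hB => ?_)
    by_contra! h
    refine hF' (F.2.prop.mem_of_subset B hB _ hA' ?_)
    rw [← F.2.prop.regularClosed B hB, closure_compl]
    refine closure_minimal (fun x hx hxA => ?_) isOpen_interior.isClosed_compl
    rw [interior_inter] at h
    exact h.subset ⟨hxA, hx⟩

theorem Theta.isOpen_lam {A : Set X} (hA : IsRegularClosed A) : IsOpen (Theta.lam A) :=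
  Theta.isTopologicalBasis.isOpen ⟨A, hA, rfl⟩

theorem Theta.isClopen_lam {A : Set X} (hA : IsRegularClosed A) : IsClopen (Theta.lam A) := by
  refine ⟨⟨?_⟩, Theta.isOpen_lam hA⟩
  rw [← Theta.lam_closure_compl hA]
  exact Theta.isOpen_lam (isRegularClosed_closure_of_isOpen hA.isClosed.isOpen_compl)

theorem Theta.exists_lam_subset {U : Set (Theta X)} (hU : IsOpen U) {F : Theta X} (hF : F ∈ U) :
    ∃ A, IsRegularClosed A ∧ A ∈ F.1 ∧ Theta.lam A ⊆ U := by
  obtain ⟨_, ⟨A, hA, rfl⟩, hFA, hAU⟩ := Theta.isTopologicalBasis.exists_subset_of_mem_open hF hU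
  exact ⟨A, hA, hFA, hAU⟩

variable (X) in
theorem Theta.isZeroDimensional : IsZeroDimensional (Theta X) :=
  Theta.isTopologicalBasis.of_isOpen_of_subset (fun _ h => h.isOpen) (by
    rintro _ ⟨A, hA, rfl⟩
    exact Theta.isClopen_lam hA)

instance : T2Space (Theta X) where
  t2 F G hFG := by
    have : ¬ F.1 ⊆ G.1 := fun h =>
      hFG (Subtype.ext (h.antisymm (F.2.le_of_ge G.2.prop h)))
    obtain ⟨A, hAF, hAG⟩ := not_subset.1 this
    have hA := Theta.isClopen_lam (F.2.prop.regularClosed A hAF)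
    exact ⟨_, _, hA.isOpen, hA.compl.isOpen, hAF, hAG, disjoint_compl_right⟩

instance : CompactSpace (Theta X) where
  isCompact_univ := by
    refine isCompact_iff_ultrafilter_le_nhds.2 fun 𝒢 _ => ?_
    -- The limit of `𝒢`. It is maximal because one of `Theta.lam A` and its complement is always in
    -- `𝒢`.
    let F : Set (Set X) := {A | IsRegularClosed A ∧ Theta.lam A ∈ 𝒢}
    have hF : IsRegularClosedFilter F := by
      refine ⟨fun A hA => hA.1, ⟨univ, isClopen_univ.isRegularClosed, ?_⟩, ?_, ?_, ?_⟩
      · refine univ_mem' fun G => ?_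
        obtain ⟨A, hA⟩ := G.2.prop.nonempty
        exact G.2.prop.mem_of_subset A hA _ isClopen_univ.isRegularClosed (subset_univ A)
      · rintro ⟨-, h⟩
        rw [Theta.lam_empty] at h
        exact 𝒢.empty_notMem h
      · rintro A ⟨hA, hA'⟩ B ⟨hB, hB'⟩
        refine ⟨isRegularClosed_closure_interior _, ?_⟩
        rw [Theta.lam_meet hA hB]
        exact inter_mem hA' hB'
      · rintro A ⟨-, hA⟩ B hB hAB
        exact ⟨hB, mem_of_superset hA (Theta.lam_mono hB hAB)⟩
    have hmax : Maximal IsRegularClosedFilter F := by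
      refine ⟨hF, fun G hG hFG A hAG => ?_⟩
      have hA := hG.regularClosed A hAG
      refine ⟨hA, ?_⟩
      by_contra h
      have hA' : closure Aᶜ ∈ G := hFG
        ⟨isRegularClosed_closure_of_isOpen hA.isClosed.isOpen_compl, by
          rw [Theta.lam_closure_compl hA]
          exact Ultrafilter.compl_mem_iff_notMem.2 h⟩
      have := hG.interior_inter_nonempty hAG hA'
      rw [interior_inter_closure_compl] at this
      exact this.ne_empty rfl
    refine ⟨⟨F, hmax⟩, mem_univ _, fun s hs => ?_⟩
    obtain ⟨U, hUs, hU, hFU⟩ := mem_nhds_iff.1 hs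
    obtain ⟨A, -, hAF, hAU⟩ := Theta.exists_lam_subset hU hFU
    exact mem_of_superset hAF.2 (hAU.trans hUs)

instance : ExtremallyDisconnected (Theta X) where
  open_closure U hU := by
    -- `closure O` is the join of all `A` with `Theta.lam A ⊆ U`; completeness of the algebra is
    -- used here.
    let O : Set X := ⋃ A ∈ {A : Set X | IsRegularClosed A ∧ Theta.lam A ⊆ U}, interior A
    have hO : IsOpen O := isOpen_biUnion fun _ _ => isOpen_interior
    have hcO := isRegularClosed_closure_of_isOpen hO
    have : closure U = Theta.lam (closure O) := by
      refine Subset.antisymm (closure_minimal (fun F hF => ?_) (Theta.isClopen_lam hcO).isClosed)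
        fun F hF => mem_closure_iff.2 fun V hV hFV => ?_
      · obtain ⟨A, hA, hAF, hAU⟩ := Theta.exists_lam_subset hU hF
        refine F.2.prop.mem_of_subset A hAF _ hcO ?_
        rw [← hA]
        exact closure_mono (subset_biUnion_of_mem (u := interior) (show A ∈ {A | _} from ⟨hA, hAU⟩))
      · obtain ⟨B, hB, hBF, hBV⟩ := Theta.exists_lam_subset hV hFV
        obtain ⟨x, hx⟩ := F.2.prop.interior_inter_nonempty hBF hF
        rw [interior_inter] at hx
        obtain ⟨y, hyB, hyO⟩ := mem_closure_iff.1 (interior_subset hx.2) _ isOpen_interior hx.1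
        obtain ⟨A, ⟨hA, hAU⟩, hyA⟩ := mem_iUnion₂.1 hyO
        obtain ⟨G, hG⟩ := Theta.exists_of_mem_interior y
        exact ⟨G, hBV (hG B hB hyB), hAU (hG A hA hyA)⟩
    rw [this]
    exact Theta.isOpen_lam hcO

end Stone

/-! ### Density, weight and the number of clopen sets -/

section Cardinals

variable {X : Type u} [TopologicalSpace X]

theorem Theta.density_le {D : Set X} (hD : Dense D) : density (Theta X) ≤ #D := by
  choose F hF using Theta.exists_of_mem_interior (X := X)
  refine le_trans (b := #(F '' D)) (csInf_le' ⟨F '' D, ?_, rfl⟩) mk_image_le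
  refine dense_iff_inter_open.2 fun U hU ⟨G, hG⟩ => ?_
  obtain ⟨A, hA, hAG, hAU⟩ := Theta.exists_lam_subset hU hG
  have hne : A.Nonempty := nonempty_iff_ne_empty.2 fun h => G.2.prop.empty_notMem (h ▸ hAG)
  obtain ⟨x, hxA, hxD⟩ := hD.inter_open_nonempty _ isOpen_interior (hA.interior_nonempty hne)
  exact ⟨F x, hAU (hF x A hA hxA), mem_image_of_mem F hxD⟩

theorem mk_regularClosed_le {D : Set X} (hD : Dense D) :
    #{A : Set X | IsRegularClosed A} ≤ 2 ^ #D := by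
  rw [← mk_set]
  refine mk_le_of_injective
    (f := fun A : {A : Set X | IsRegularClosed A} => (Subtype.val ⁻¹' interior A.1 : Set D)) ?_
  intro A B h
  -- `A` is recovered as the closure of the trace of its interior on `D`.
  have key : ∀ A : {A : Set X | IsRegularClosed A},
      closure (Subtype.val '' (Subtype.val ⁻¹' interior A.1 : Set D)) = A.1 := fun A => by
    rw [Subtype.image_preimage_coe, inter_comm]
    refine Subset.antisymm ?_ ?_
    · exact (closure_mono inter_subset_left).trans A.2.subset
    · conv_lhs => rw [← show closure (interior A.1) = A.1 from A.2]
      exact closure_minimal (hD.open_subset_closure_inter isOpen_interior) isClosed_closure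
  exact Subtype.ext (by rw [← key A, ← key B]; exact congrArg (fun s => closure (_ '' s)) h)

theorem Theta.weight_le {D : Set X} (hD : Dense D) : weight (Theta X) ≤ 2 ^ #D :=
  le_trans (csInf_le' ⟨_, Theta.isTopologicalBasis, rfl⟩)
    ((mk_image_le (f := Theta.lam) (s := {A : Set X | IsRegularClosed A})).trans
      (mk_regularClosed_le hD))

theorem mk_clopen_le_two_power_density (Y : Type u) [TopologicalSpace Y] :
    #{s : Set Y | IsClopen s} ≤ 2 ^ density Y := by
  obtain ⟨D, hD, hDc⟩ := csInf_mem (s := {c | ∃ D : Set Y, Dense D ∧ #D = c})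
    ⟨_, univ, dense_univ, rfl⟩
  rw [density, ← hDc]
  exact (mk_le_mk_of_subset fun s hs => IsClopen.isRegularClosed hs).trans
    (mk_regularClosed_le hD)

/-- By compactness a clopen set is a finite union of members of a base, and an infinite base has as
many finite subsets as members. -/
theorem mk_clopen_le_weight {Y : Type u} [TopologicalSpace Y] [CompactSpace Y]
    (h : ℵ₀ ≤ #{s : Set Y | IsClopen s}) : #{s : Set Y | IsClopen s} ≤ weight Y := by
  refine le_csInf ⟨_, _, TopologicalSpace.isTopologicalBasis_opens, rfl⟩ ?_
  rintro _ ⟨B, hB, rfl⟩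
  choose f hf using fun s : {s : Set Y | IsClopen s} =>
    eq_sUnion_finset_of_isTopologicalBasis_of_isCompact_open B hB s.1
      s.2.isClosed.isCompact s.2.isOpen
  have hinj : Function.Injective f := fun s t hst =>
    Subtype.ext (by rw [hf s, hf t, hst])
  have hle := mk_le_of_injective hinj
  have : Infinite (Finset B) := infinite_iff.2 (h.trans hle)
  have : Infinite B := by
    by_contra hfin
    rw [not_infinite_iff_finite] at hfin
    exact not_finite (Finset B)
  rwa [mk_finset_of_infinite] at hle

end Cardinals

/-! ### The Cantor cube -/

section Cube

variable {I : Type u}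

theorem exists_finset_eqOn_imp_mem {O : Set (I → Bool)} (hO : IsOpen O) {y : I → Bool}
    (hy : y ∈ O) : ∃ S : Finset I, ∀ z : I → Bool, (∀ i ∈ S, z i = y i) → z ∈ O := by
  obtain ⟨S, u, hu, hS⟩ := isOpen_pi_iff.1 hO y hy
  exact ⟨S, fun z hz => hS fun i hi => by rw [hz i hi]; exact (hu i hi).2⟩

theorem isClopen_coordinate (i : I) (b : Bool) : IsClopen {z : I → Bool | z i = b} :=
  (isClopen_discrete {b}).preimage (continuous_apply i)

theorem Theta.lam_coordinate_injective :
    Function.Injective fun i : I => Theta.lam {z : I → Bool | z i = true} := by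
  classical
  intro i j h
  by_contra hij
  obtain ⟨F, hF⟩ := Theta.exists_of_mem_interior (Function.update (fun _ => false) i true : I → Bool)
  have hmem : ∀ k b, (Function.update (fun _ => false) i true : I → Bool) k = b → {z : I → Bool | z k = b} ∈ F.1 :=
    fun k b hk => hF _ (isClopen_coordinate k b).isRegularClosed
      (by rw [(isClopen_coordinate k b).isOpen.interior_eq]; exact hk)
  have h1 : F ∈ Theta.lam {z : I → Bool | z j = true} :=
    h.subset (hmem i true (by simp))
  obtain ⟨z, hz⟩ := F.2.prop.interior_inter_nonempty h1
    (hmem j false (by simp [Ne.symm hij]))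
  obtain ⟨hz1, hz2⟩ := interior_subset hz
  exact Bool.noConfusion ((mem_ofPred.1 hz1).symm.trans hz2)

theorem mk_le_mk_clopen_theta_cube :
    #I ≤ #{s : Set (Theta (I → Bool)) | IsClopen s} :=
  mk_le_of_injective
    (f := fun i : I => ⟨_, Theta.isClopen_lam (isClopen_coordinate i true).isRegularClosed⟩)
    fun _ _ h => Theta.lam_coordinate_injective (congrArg Subtype.val h)

theorem Theta.not_isOpen_singleton_cube [Infinite I] (F : Theta (I → Bool)) :
    ¬ IsOpen ({F} : Set (Theta (I → Bool))) := by
  classical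
  intro hF
  obtain ⟨A, hA, hAF, hAs⟩ := Theta.exists_lam_subset hF rfl
  have hne : A.Nonempty := nonempty_iff_ne_empty.2 fun h => F.2.prop.empty_notMem (h ▸ hAF)
  obtain ⟨y, hy⟩ := hA.interior_nonempty hne
  obtain ⟨S, hS⟩ := exists_finset_eqOn_imp_mem isOpen_interior hy
  obtain ⟨i, hi⟩ := Infinite.exists_notMem_finset S
  -- Changing the free coordinate `i` of `y` stays inside `A`, so `F`, the only point of `Theta.lam
  -- A`, would contain both halves of the cube.
  have hmem : ∀ b, {z : I → Bool | z i = b} ∈ F.1 := fun b => by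
    obtain ⟨G, hG⟩ := Theta.exists_of_mem_interior (Function.update y i b)
    have hGA : G ∈ Theta.lam A := hG A hA (hS _ fun j hj =>
      Function.update_of_ne (fun h => hi (by rwa [← h])) _ _)
    rw [← show G = F from hAs hGA]
    refine hG _ (isClopen_coordinate i b).isRegularClosed ?_
    rw [(isClopen_coordinate i b).isOpen.interior_eq]
    simp
  obtain ⟨z, hz⟩ := F.2.prop.interior_inter_nonempty (hmem true) (hmem false)
  obtain ⟨hz1, hz2⟩ := interior_subset hz
  exact Bool.noConfusion ((mem_ofPred.1 hz1).symm.trans hz2)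

/-- Hewitt–Marczewski–Pondiczery for powers of the two-point space. -/
theorem exists_dense_cube {K : Type u} [Infinite K] (e : I ↪ Set K) :
    ∃ D : Set (I → Bool), Dense D ∧ #D ≤ #K := by
  classical
  -- Indices are coded as subsets of `K`. A pair consists of a finite test set and a list of
  -- accepted traces on it.
  let f : Finset K × Finset (Finset K) → I → Bool :=
    fun p i => decide (p.1.filter (· ∈ e i) ∈ p.2)
  refine ⟨range f, ?_, mk_range_le.trans ?_⟩
  · refine dense_iff_inter_open.2 fun O hO ⟨y, hy⟩ => ?_
    obtain ⟨S, hS⟩ := exists_finset_eqOn_imp_mem hO hy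
    have hsep : ∀ i j : I, i ≠ j → ∃ k : K, ¬ (k ∈ e i ↔ k ∈ e j) := fun i j hij => by
      by_contra! h
      exact hij (e.injective (Set.ext h))
    choose! k hk using hsep
    -- A finite test set on which distinct indices in `S` have distinct traces; the arbitrary values
    -- of `k` on the diagonal are harmless.
    let G : Finset K := (S ×ˢ S).image fun p => k p.1 p.2
    have hG : ∀ i ∈ S, ∀ j ∈ S, G.filter (· ∈ e i) = G.filter (· ∈ e j) → i = j := by
      intro i hi j hj h
      by_contra hij
      refine hk i j hij ?_
      have hkG : k i j ∈ G := Finset.mem_image.2 ⟨(i, j), Finset.mk_mem_product hi hj, rfl⟩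
      simpa [hkG] using Finset.ext_iff.1 h (k i j)
    let P : Finset (Finset K) := (S.filter (y · = true)).image fun i => G.filter (· ∈ e i)
    refine ⟨f (G, P), hS _ fun i hi => ?_, mem_range_self _⟩
    have : G.filter (· ∈ e i) ∈ P ↔ y i = true := by
      refine ⟨fun h => ?_, fun h =>
        Finset.mem_image.2 ⟨i, Finset.mem_filter.2 ⟨hi, h⟩, rfl⟩⟩
      obtain ⟨j, hj, hji⟩ := Finset.mem_image.1 h
      obtain ⟨hjS, hyj⟩ := Finset.mem_filter.1 hj
      rwa [← hG j hjS i hi hji]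
    change decide (G.filter (· ∈ e i) ∈ P) = y i
    simp only [this, Bool.decide_eq_true]
  · rw [mk_prod, lift_id, lift_id, mk_finset_of_infinite, mk_finset_of_infinite,
      mk_finset_of_infinite, mul_eq_self (aleph0_le_mk K)]

end Cube

/-! ### Use of GCH and conclusion -/

/-- If `c < κ`, then `2 ^ c ≤ κ < 2 ^ κ`: for infinite `c`, GCH makes `2 ^ c` the successor of `c`.
-/
theorem GCH.le_of_two_power_le (gch : GCH.{u}) {κ c : Cardinal.{u}} (hκ : ℵ₀ ≤ κ)
    (h : (2 : Cardinal.{u}) ^ κ ≤ 2 ^ c) : κ ≤ c := by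
  by_contra! hc
  refine (h.trans ?_).not_gt (cantor κ)
  rcases lt_or_ge c ℵ₀ with hfin | hinf
  · exact (power_lt_aleph0 (natCast_lt_aleph0 (n := 2)) hfin).le.trans hκ
  · rw [gch c hinf]
    exact Order.succ_le_of_lt hc

theorem mainTheorem8 (gch : GCH.{u}) (κ : Cardinal.{u}) (hκ : ℵ₀ ≤ κ) :
    CompactSpace (ZSpace κ) ∧ T2Space (ZSpace κ) ∧ IsZeroDimensional (ZSpace κ) ∧
      IsSHD (ZSpace κ) ∧ density (ZSpace κ) = κ ∧ weight (ZSpace κ) = 2 ^ κ := by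
  have hI : #((2 : Cardinal.{u}) ^ κ).out = 2 ^ κ := mk_out _
  have hinf : ℵ₀ ≤ (2 : Cardinal.{u}) ^ κ := hκ.trans (cantor κ).le
  have : Infinite ((2 : Cardinal.{u}) ^ κ).out := infinite_iff.2 (hI.symm ▸ hinf)
  have : Infinite κ.out := infinite_iff.2 ((mk_out κ).symm ▸ hκ)
  have hclopen : 2 ^ κ ≤ #{s : Set (ZSpace κ) | IsClopen s} :=
    hI.symm.le.trans mk_le_mk_clopen_theta_cube
  obtain ⟨e⟩ : Nonempty (((2 : Cardinal.{u}) ^ κ).out ↪ Set κ.out) := by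
    rw [← Cardinal.le_def, hI, mk_set, mk_out]
  obtain ⟨D, hD, hDκ⟩ := exists_dense_cube e
  rw [mk_out] at hDκ
  refine ⟨inferInstance, inferInstance, Theta.isZeroDimensional _,
    isSHD_of_extremallyDisconnected Theta.not_isOpen_singleton_cube,
    ((Theta.density_le hD).trans hDκ).antisymm
      (gch.le_of_two_power_le hκ (hclopen.trans (mk_clopen_le_two_power_density _))),
    ((Theta.weight_le hD).trans (power_le_power_left two_ne_zero hDκ)).antisymm
      (hclopen.trans (mk_clopen_le_weight (hinf.trans hclopen)))⟩
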